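/- Let $M$ be a structure for a first-order language $L$. For $A\subseteq M$, a formula $\varphi(x)$ of $L(A)$ (that is, with parameters from $A$) with one free variable is called $A$-typical if its extension $X=\{x\in M: M\models\varphi(x)\}$ contains the majority of elements of $M$, i.e. $|X|>|M\setminus X|$. For $a\in M$ and a finite tuple $\overline b$ of elements of $M$, write $\mathsf{Tp}(a,\overline b)$ if $a$ satisfies every $\overline b$-typical formula (parameters from the set of entries of $\overline b$), and $\mathsf{Tp}(a)$ when $\overline b$ is empty. Let $\mathrm{df}(A)$ be the set of $A$-definable elements of $M$, i.e. those $b\in M$ for which some formula $\varphi(x)$ of $L(A)$ is satisfied by $b$ and by no other element of $M$; write $\mathrm{df}(b)$ for $\mathrm{df}(\{b\})$. The Steinitz exchange axiom T5 for $M$ is the statement that for all $a,b\in M$ and all finite tuples $\overline c$ of elements of $M$, $\mathsf{Tp}(a,\overline c)$ and $\mathsf{Tp}(b,a\overline c)$ imply $\mathsf{Tp}(a,b\overline c)$. Let $M=(M,S,+,\cdot,0)$ be any countable nonstandard model of first-order Peano arithmetic PA, and let $a,b\in M$ be such that $a\notin\mathrm{df}(\emptyset)$, $a\in\mathrm{df}(b)$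 and $b\notin\mathrm{df}(a)$. Then, in $M$, $\mathsf{Tp}(a)$ and $\mathsf{Tp}(b,a)$ hold while $\mathsf{Tp}(a,b)$ fails; hence the Steinitz exchange axiom T5 fails in $M$. Moreover, there exist a countable nonstandard model $M$ of PA and elements $a,b\in M$ with $a\notin\mathrm{df}(\emptyset)$, $a\in\mathrm{df}(b)$ and $b\notin\mathrm{df}(a)$. -/

import Mathlib

open FirstOrder
open scoped Cardinal

/-- The function symbols `0`, `S`, `+`, `·` of the language of arithmetic. -/
inductive ArithFunc : ℕ → Type
  | zero : ArithFunc 0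
  | succ : ArithFunc 1
  | add : ArithFunc 2
  | mul : ArithFunc 2

/-- The language of arithmetic, with function symbols `S`, `+`, `·`, `0` and equality only. -/
def arith : FirstOrder.Language :=
  { Functions := ArithFunc
    Relations := fun _ => Empty }

namespace arith

open FirstOrder.Language

/-- The term `0`. -/
def zeroT {α : Type*} : arith.Term α := Constants.term ArithFunc.zero

/-- The term `S t`. -/
def succT {α : Type*} (t : arith.Term α) : arith.Term α := Functions.apply₁ ArithFunc.succ t

/-- The term `s + t`. -/
def addT {α : Type*} (s t : arith.Term α) : arith.Term α := Functions.apply₂ ArithFunc.add s t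

/-- The term `s · t`. -/
def mulT {α : Type*} (s t : arith.Term α) : arith.Term α := Functions.apply₂ ArithFunc.mul s t

/-- The standard structure `(ℕ, S, +, ·, 0)`. -/
instance natStructure : arith.Structure ℕ where
  funMap := fun f v =>
    match f, v with
    | ArithFunc.zero, _ => 0
    | ArithFunc.succ, v => v 0 + 1
    | ArithFunc.add, v => v 0 + v 1
    | ArithFunc.mul, v => v 0 * v 1
  RelMap := fun r _ => Empty.elim r

/-- `∀ x, S x ≠ 0`. -/
def axSuccNeZero : arith.Sentence := ∀' ∼(succT (&0) =' zeroT)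

/-- `∀ x y, S x = S y → x = y`. -/
def axSuccInj : arith.Sentence := ∀' ∀' ((succT (&0) =' succT (&1)) ⟹ ((&0) =' (&1)))

/-- `∀ x, x + 0 = x`. -/
def axAddZero : arith.Sentence := ∀' (addT (&0) zeroT =' (&0))

/-- `∀ x y, x + S y = S (x + y)`. -/
def axAddSucc : arith.Sentence :=
  ∀' ∀' (addT (&0) (succT (&1)) =' succT (addT (&0) (&1)))

/-- `∀ x, x · 0 = 0`. -/
def axMulZero : arith.Sentence := ∀' (mulT (&0) zeroT =' zeroT)

/-- `∀ x y, x · S y = x · y + x`. -/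
def axMulSucc : arith.Sentence :=
  ∀' ∀' (mulT (&0) (succT (&1)) =' addT (mulT (&0) (&1)) (&0))

/-- For a formula `φ(p, x)` with parameters `p = (p₀, …, pₙ₋₁)` and one more free variable `x`,
the formula `φ(p, 0) ∧ (∀ x, φ(p, x) → φ(p, S x)) → ∀ x, φ(p, x)`. -/
noncomputable def inductionFormula {n : ℕ} (φ : arith.Formula (Fin n ⊕ Unit)) :
    arith.Formula (Fin n) :=
  (BoundedFormula.subst φ (Sum.elim (fun i => Term.var i) (fun _ => zeroT)) ⊓
    Formula.iAlls Unit (φ ⟹ BoundedFormula.subst φ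
      (Sum.elim (fun i => Term.var (Sum.inl i)) (fun x => succT (Term.var (Sum.inr x)))))) ⟹
  Formula.iAlls Unit φ

/-- The universal closure of `inductionFormula φ`. -/
noncomputable def axInduction {n : ℕ} (φ : arith.Formula (Fin n ⊕ Unit)) : arith.Sentence :=
  Formula.iAlls (Fin n) (Formula.relabel (Sum.inr : Fin n → Empty ⊕ Fin n) (inductionFormula φ))

/-- First-order Peano arithmetic. -/
noncomputable def PA : arith.Theory :=
  {axSuccNeZero, axSuccInj, axAddZero, axAddSucc, axMulZero, axMulSucc} ∪
    {σ | ∃ (n : ℕ) (φ : arith.Formula (Fin n ⊕ Unit)), σ = axInduction φ}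

/-- A structure for the language of arithmetic is nonstandard if it is not isomorphic to `ℕ`. -/
def Nonstandard (M : Type*) [arith.Structure M] : Prop := IsEmpty (ℕ ≃[arith] M)

end arith

namespace Typicality

open FirstOrder.Language

/-- The class of majority subsets of `M`: those with more elements than their complement. -/
def mj (M : Type*) : Set (Set M) := {X | #(Xᶜ : Set M) < #X}

section

variable (L : FirstOrder.Language) {M : Type*} [L.Structure M]

/-- The extension in `M` of a property `φ(x)` of `L(A)`. -/
def ext {A : Set M} (φ : L[[A]].Formula Unit) : Set M := {x | φ.Realize (fun _ => x)}

/-- The set of `A`-typical properties over `M`. -/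
def TP (A : Set M) : Set (L[[A]].Formula Unit) := {φ | ext L φ ∈ mj M}

/-- `a` is an `A`-typical element of `M`. -/
def IsTypical (A : Set M) (a : M) : Prop := ∀ φ ∈ TP L A, a ∈ ext L φ

/-- Relative typicality `Tp(a, b₁ … bₙ)`: `a` is `{b₁, …, bₙ}`-typical. -/
def Tp (a : M) (b : List M) : Prop := IsTypical L {x | x ∈ b} a

/-- The set of `A`-definable elements of `M`: those that are the unique element satisfying some
formula with parameters in `A`. -/
def df (A : Set M) : Set M := {b | ∃ φ : L[[A]].Formula Unit, ∀ x, x ∈ ext L φ ↔ x = b}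

variable (M) in
/-- The Steinitz exchange principle for typicality over `M`:
`Tp(a, c)` and `Tp(b, a c)` imply `Tp(a, b c)`, for all `a`, `b` and all finite tuples `c`. -/
def SteinitzExchange : Prop :=
  ∀ (a b : M) (c : List M), Tp L a c → Tp L b (a :: c) → Tp L a (b :: c)

end

end Typicality

/-!
In a countably infinite structure the majority sets are exactly the cofinite ones
(`Typicality.mem_mj_iff`), so an element is typical over `A` if and only if it belongs to no finite
`A`-definable set. In a model of Peano arithmetic the relation `∃ z, x + z = y` is a definable
linear order (`arith.linearOrderOfPA`), so every element of a finite `A`-definable set is itself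
`A`-definable (`Typicality.mem_df_of_finite`): it can be reached by removing the largest element
finitely often. Hence typicality over a finite tuple is undefinability from it
(`Typicality.tp_iff_notMem_df`), and the hypotheses on `a` and `b` say literally that `Tp(a)` and
`Tp(b, a)` hold and `Tp(a, b)` fails.

For the existence of such `a` and `b`, take by the Löwenheim–Skolem theorem an uncountable structure
elementarily equivalent to `ℕ`. Only countably many of its elements are definable from a given one,
so it has an element `a` undefinable from `0` and an element `c` undefinable from `a`. Pass to a
countable elementary substructure containing `a` and `c`, and let `b = (a + c)² + a`. The polynomial
pairing is injective in `ℕ`, hence in the substructure, so both `a` and `c` are definable from `b`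
(`arith.mem_df_pairM`); if `b` were definable from `a`, so would `c` be. The model is nonstandard
because all elements of `ℕ` are definable.
-/

namespace arith

open FirstOrder.Language

/-! ### Semantics of the language of arithmetic -/

section Operations

variable {M : Type*} [arith.Structure M] {α : Type*} {v : α → M}

variable (M) in
/-- The interpretation of the symbol `0` in `M`. -/
def zeroM : M := Structure.funMap (L := arith) (M := M) ArithFunc.zero ![]

/-- The interpretation of the symbol `S` in `M`. -/
def succM (x : M) : M := Structure.funMap (L := arith) (M := M) ArithFunc.succ ![x]

/-- The interpretation of the symbol `+` in `M`. -/
def addM (x y : M) : M := Structure.funMap (L := arith) (M := M) ArithFunc.add ![x, y]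

/-- The interpretation of the symbol `·` in `M`. -/
def mulM (x y : M) : M := Structure.funMap (L := arith) (M := M) ArithFunc.mul ![x, y]

@[simp] lemma realize_zeroT : (zeroT : arith.Term α).realize v = zeroM M := by
  simp only [zeroT, zeroM, Constants.term, Term.realize]
  congr 1
  exact Subsingleton.elim _ _

@[simp] lemma realize_succT (t : arith.Term α) : (succT t).realize v = succM (t.realize v) :=
  Term.realize_functions_apply₁

@[simp] lemma realize_addT (s t : arith.Term α) :
    (addT s t).realize v = addM (s.realize v) (t.realize v) :=
  Term.realize_functions_apply₂

@[simp] lemma realize_mulT (s t : arith.Term α) :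
    (mulT s t).realize v = mulM (s.realize v) (t.realize v) :=
  Term.realize_functions_apply₂

/-- An instance of the induction scheme holds in `M` exactly when induction is valid in `M` for the
corresponding property, whatever the parameters. -/
lemma realize_axInduction {n : ℕ} (φ : arith.Formula (Fin n ⊕ Unit)) :
    M ⊨ axInduction φ ↔ ∀ p : Fin n → M, φ.Realize (Sum.elim p fun _ => zeroM M) →
      (∀ x, φ.Realize (Sum.elim p fun _ => x) → φ.Realize (Sum.elim p fun _ => succM x)) →
      ∀ x, φ.Realize (Sum.elim p fun _ => x) := by
  have key : ∀ (p : Fin n → M) (t : Fin n ⊕ Unit → arith.Term (Fin n)) (x : M),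
      (∀ i, (t (.inl i)).realize p = p i) → (t (.inr ())).realize p = x →
      (BoundedFormula.Realize (BoundedFormula.subst φ t) p default ↔
        φ.Realize (Sum.elim p fun _ => x)) := by
    intro p t x h1 h2
    rw [BoundedFormula.realize_subst, Formula.Realize]
    have : (fun a => (t a).realize p) = Sum.elim p fun _ => x := by
      funext a; rcases a with i | i
      · exact h1 i
      · exact h2
    rw [this]
  have key2 : ∀ (p : Fin n → M) (i : Unit → M),
      (BoundedFormula.Realize (BoundedFormula.subst φ
      (Sum.elim (fun i => Term.var (Sum.inl i)) (fun x => succT (Term.var (Sum.inr x)))))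
        (fun a => Sum.elim p i a) default ↔
        φ.Realize (Sum.elim p fun _ => succM (i ()))) := by
    intro p i
    rw [BoundedFormula.realize_subst, Formula.Realize]
    have : (fun a => ((Sum.elim (fun i => Term.var (Sum.inl i))
      (fun x => succT (Term.var (Sum.inr x))) : Fin n ⊕ Unit → arith.Term (Fin n ⊕ Unit)) a).realize
        (fun a => Sum.elim p i a)) = Sum.elim p fun _ => succM (i ()) := by
      funext a; rcases a with j | j <;> simp
    rw [this]
  -- quantification over `Unit → M` is quantification over `M`
  have hu : ∀ {P : (Unit → M) → Prop}, (∀ i, P i) ↔ ∀ x : M, P fun _ => x :=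
    fun {P} => ⟨fun h x => h _, fun h i => h (i ())⟩
  rw [axInduction, Sentence.Realize, Formula.realize_iAlls]
  refine forall_congr' fun p => ?_
  rw [Formula.realize_relabel]
  have hp : (fun a => Sum.elim (default : Empty → M) p a) ∘ (Sum.inr : Fin n → Empty ⊕ Fin n) = p :=
    rfl
  rw [hp, inductionFormula, Formula.Realize, BoundedFormula.realize_imp,
    BoundedFormula.realize_inf, BoundedFormula.realize_iAlls, BoundedFormula.realize_iAlls, hu, hu,
    key p _ (zeroM M) (fun _ => rfl) realize_zeroT, and_imp]
  refine imp_congr_right fun _ => imp_congr (forall_congr' fun x => ?_) Iff.rfl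
  rw [Formula.Realize, BoundedFormula.realize_imp, key2]
  rfl

end Operations

lemma nat_models_PA : ℕ ⊨ PA := by
  rw [Theory.model_iff]
  rintro σ ((rfl | rfl | rfl | rfl | rfl | rfl) | ⟨n, φ, rfl⟩)
  · simp [axSuccNeZero, Sentence.Realize, Formula.Realize, succM, zeroM, Structure.funMap]
  · simp [axSuccInj, Sentence.Realize, Formula.Realize, succM, Structure.funMap, Fin.snoc]
  · simp [axAddZero, Sentence.Realize, Formula.Realize, addM, zeroM, Structure.funMap]
  · simp [axAddSucc, Sentence.Realize, Formula.Realize, addM, succM, Structure.funMap, Nat.add_assoc]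
  · simp [axMulZero, Sentence.Realize, Formula.Realize, mulM, zeroM, Structure.funMap]
  · simp [axMulSucc, Sentence.Realize, Formula.Realize, mulM, addM, succM, Structure.funMap,
      Nat.mul_succ]
  · rw [realize_axInduction]
    intro p h0 hs x
    induction x with
    | zero => exact h0
    | succ k ih => exact hs k ih

/-! ### The order of a model of arithmetic -/

section Model

variable {M : Type*} [arith.Structure M] [hM : M ⊨ PA]

lemma succM_ne_zeroM (x : M) : succM x ≠ zeroM M := by
  have := hM.realize_of_mem axSuccNeZero (by simp [PA])
  simp [axSuccNeZero, Sentence.Realize, Formula.Realize] at this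
  exact this x

lemma succM_injective : Function.Injective (succM : M → M) := fun x y h => by
  have := hM.realize_of_mem axSuccInj (by simp [PA])
  simp [axSuccInj, Sentence.Realize, Formula.Realize, Fin.snoc] at this
  exact this x y h

lemma addM_zeroM (x : M) : addM x (zeroM M) = x := by
  have := hM.realize_of_mem axAddZero (by simp [PA])
  simp [axAddZero, Sentence.Realize, Formula.Realize] at this
  exact this x

lemma addM_succM (x y : M) : addM x (succM y) = succM (addM x y) := by
  have := hM.realize_of_mem axAddSucc (by simp [PA])
  simp [axAddSucc, Sentence.Realize, Formula.Realize, Fin.snoc] at this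
  exact this x y

/-- The induction scheme of `PA`, for a property `P` of elements of a model that is defined by a
formula `φ` with parameters `p`. -/
lemma induction_of_definable {n : ℕ} (φ : arith.Formula (Fin n ⊕ Unit)) (p : Fin n → M)
    {P : M → Prop} (hφ : ∀ x, φ.Realize (Sum.elim p fun _ => x) ↔ P x) (zero : P (zeroM M))
    (succ : ∀ x, P x → P (succM x)) (x : M) : P x := by
  simpa only [hφ] using (realize_axInduction φ).1
    (hM.realize_of_mem (axInduction φ) (Or.inr ⟨n, φ, rfl⟩)) p ((hφ _).2 zero)
    (fun x hx => (hφ _).2 (succ x ((hφ _).1 hx))) x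

lemma zeroM_addM (x : M) : addM (zeroM M) x = x :=
  induction_of_definable (P := fun x => addM (zeroM M) x = x)
    ((addT zeroT (Term.var (.inr ()))).equal (Term.var (.inr ()))) ![] (by simp)
    (addM_zeroM _) (fun x hx => by rw [addM_succM, hx]) x

lemma succM_addM (x y : M) : addM (succM x) y = succM (addM x y) :=
  induction_of_definable (P := fun y => addM (succM x) y = succM (addM x y))
    ((addT (succT (Term.var (.inl 0))) (Term.var (.inr ()))).equal
      (succT (addT (Term.var (.inl 0)) (Term.var (.inr ()))))) ![x] (by simp)
    (by rw [addM_zeroM, addM_zeroM]) (fun y hy => by rw [addM_succM, hy, addM_succM]) y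

lemma addM_comm (x y : M) : addM x y = addM y x :=
  induction_of_definable (P := fun y => addM x y = addM y x)
    ((addT (Term.var (.inl 0)) (Term.var (.inr ()))).equal
      (addT (Term.var (.inr ())) (Term.var (.inl 0)))) ![x] (by simp)
    (by rw [addM_zeroM, zeroM_addM]) (fun y hy => by rw [addM_succM, hy, succM_addM]) y

lemma addM_assoc (x y z : M) : addM (addM x y) z = addM x (addM y z) :=
  induction_of_definable (P := fun z => addM (addM x y) z = addM x (addM y z))
    ((addT (addT (Term.var (.inl 0)) (Term.var (.inl 1))) (Term.var (.inr ()))).equal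
      (addT (Term.var (.inl 0)) (addT (Term.var (.inl 1)) (Term.var (.inr ()))))) ![x, y] (by simp)
    (by simp only [addM_zeroM]) (fun z hz => by simp only [addM_succM, hz]) z

lemma addM_right_cancel {x y z : M} : addM x z = addM y z → x = y :=
  induction_of_definable (P := fun z => addM x z = addM y z → x = y)
    (((addT (Term.var (.inl 0)) (Term.var (.inr ()))).equal
      (addT (Term.var (.inl 1)) (Term.var (.inr ())))) ⟹
      (Term.var (.inl 0)).equal (Term.var (.inl 1))) ![x, y] (by simp [Formula.realize_imp])
    (by simp only [addM_zeroM, imp_self])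
    (fun z hz h => hz (succM_injective (by rwa [addM_succM, addM_succM] at h))) z

lemma eq_zeroM_or_succM (x : M) : x = zeroM M ∨ ∃ y, x = succM y :=
  induction_of_definable (P := fun x => x = zeroM M ∨ ∃ y, x = succM y)
    (((Term.var (.inr ())).equal zeroT) ⊔ Formula.iExs Unit
      ((Term.var (.inl (.inr ()))).equal (succT (Term.var (.inr ())))))
    ![] (fun x => by
      simp only [Formula.realize_sup, Formula.realize_iExs, Formula.realize_equal, realize_zeroT,
        realize_succT, Term.realize_var, Sum.elim_inl, Sum.elim_inr]
      exact or_congr_right ⟨fun ⟨i, h⟩ => ⟨i (), h⟩, fun ⟨y, h⟩ => ⟨fun _ => y, h⟩⟩)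
    (Or.inl rfl) (fun x _ => Or.inr ⟨x, rfl⟩) x

lemma eq_zeroM_of_addM_eq_zeroM {x y : M} (h : addM x y = zeroM M) : y = zeroM M := by
  rcases eq_zeroM_or_succM y with rfl | ⟨z, rfl⟩
  · rfl
  · rw [addM_succM] at h
    exact absurd h (succM_ne_zeroM _)

/-- The formula `∃ z, s + z = t`, that is, `s ≤ t`. -/
noncomputable def leF {α : Type*} (s t : α) : arith.Formula α :=
  Formula.iExs Unit
    ((addT (Term.var (.inl s)) (Term.var (.inr ()))).equal (Term.var (.inl t)))

@[simp] lemma realize_leF {N : Type*} [arith.Structure N] {α : Type*} (s t : α) (v : α → N) :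
    (leF s t).Realize v ↔ ∃ z, addM (v s) z = v t := by
  simp only [leF, Formula.realize_iExs, Formula.realize_equal, realize_addT, Term.realize_var,
    Sum.elim_inl, Sum.elim_inr]
  exact ⟨fun ⟨i, h⟩ => ⟨i (), h⟩, fun ⟨z, h⟩ => ⟨fun _ => z, h⟩⟩

lemma exists_addM_total (x y : M) : (∃ z, addM x z = y) ∨ ∃ z, addM y z = x :=
  induction_of_definable (P := fun y => (∃ z, addM x z = y) ∨ ∃ z, addM y z = x)
    (leF (.inl 0) (.inr ()) ⊔ leF (.inr ()) (.inl 0)) ![x] (by simp)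
    (Or.inr ⟨x, zeroM_addM x⟩) (fun y hy => by
      rcases hy with ⟨z, rfl⟩ | ⟨z, rfl⟩
      · exact Or.inl ⟨succM z, addM_succM x z⟩
      · rcases eq_zeroM_or_succM z with rfl | ⟨w, rfl⟩
        · exact Or.inl ⟨succM (zeroM M), by simp only [addM_succM, addM_zeroM]⟩
        · exact Or.inr ⟨w, by rw [succM_addM, addM_succM]⟩) y

variable (M) in
/-- The natural order of a model of `PA`: `x ≤ y` means that `x + z = y` for some `z`. -/
@[reducible] noncomputable def linearOrderOfPA : LinearOrder M where
  le x y := ∃ z, addM x z = y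
  le_refl x := ⟨zeroM M, addM_zeroM x⟩
  le_trans := by
    rintro x _ _ ⟨z, rfl⟩ ⟨w, rfl⟩
    exact ⟨addM z w, (addM_assoc _ _ _).symm⟩
  le_antisymm := by
    rintro x _ ⟨z, rfl⟩ ⟨w, h⟩
    have h0 : addM z w = zeroM M := addM_right_cancel (z := x) <| by
      rw [zeroM_addM, addM_comm, ← addM_assoc, h]
    rw [addM_comm] at h0
    rw [eq_zeroM_of_addM_eq_zeroM h0, addM_zeroM]
  le_total := exists_addM_total
  toDecidableLE := Classical.decRel _

lemma infinite_of_models_PA : Infinite M :=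
  .of_injective_to_set (s := {zeroM M}ᶜ) (f := fun x => ⟨succM x, succM_ne_zeroM x⟩)
    (by simp) fun x y h => succM_injective (congrArg Subtype.val h)

end Model

end arith

namespace Typicality

open FirstOrder.Language

/-! ### Definable elements -/

section Definability

variable {L : FirstOrder.Language} {M : Type*} [L.Structure M]

lemma mem_ext_iff {A : Set M} (φ : L[[A]].Formula Unit) (x : M) :
    x ∈ ext L φ ↔ Formula.Realize (BoundedFormula.constantsVarsEquiv φ : L.Formula (A ⊕ Unit))
      (Sum.elim (fun a => (a : M)) fun _ => x) :=
  (BoundedFormula.realize_constantsVarsEquiv (φ := φ)).symm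

/-- Constants for elements of `A` can be traded for free variables evaluated at those elements. -/
lemma exists_ext_eq_iff {A : Set M} {X : Set M} :
    (∃ φ : L[[A]].Formula Unit, ext L φ = X) ↔
      ∃ ψ : L.Formula (A ⊕ Unit),
        ∀ x, ψ.Realize (Sum.elim (fun a => (a : M)) fun _ => x) ↔ x ∈ X := by
  constructor
  · rintro ⟨φ, rfl⟩
    exact ⟨BoundedFormula.constantsVarsEquiv φ, fun x => (mem_ext_iff φ x).symm⟩
  · rintro ⟨ψ, h⟩
    refine ⟨BoundedFormula.constantsVarsEquiv.symm ψ, Set.ext fun x => ?_⟩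
    rw [mem_ext_iff, Equiv.apply_symm_apply, h]

lemma mem_df_iff {A : Set M} {b : M} :
    b ∈ df L A ↔ ∃ ψ : L.Formula (A ⊕ Unit),
      ∀ x, ψ.Realize (Sum.elim (fun a => (a : M)) fun _ => x) ↔ x = b := by
  refine Iff.trans ?_ (exists_ext_eq_iff (X := {b}))
  simp [df, Set.ext_iff]

lemma mem_df_singleton_iff {a b : M} :
    b ∈ df L {a} ↔ ∃ ψ : L.Formula (Unit ⊕ Unit),
      ∀ x, ψ.Realize (Sum.elim (fun _ => a) fun _ => x) ↔ x = b := by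
  rw [mem_df_iff]
  constructor
  · rintro ⟨ψ, h⟩
    refine ⟨ψ.relabel (Sum.map (fun _ => ()) id), fun x => ?_⟩
    rw [Formula.realize_relabel, ← h]
    have : (Sum.elim (fun _ => a) fun _ => x) ∘ Sum.map (fun _ => ()) id =
        (Sum.elim (fun a => (a : M)) fun _ => x : ({a} : Set M) ⊕ Unit → M) := by
      funext i
      rcases i with ⟨i, rfl⟩ | i <;> rfl
    rw [this]
  · rintro ⟨ψ, h⟩
    refine ⟨ψ.relabel (Sum.map (fun _ => ⟨a, rfl⟩) id), fun x => ?_⟩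
    rw [Formula.realize_relabel, ← h]
    have : (Sum.elim (fun a => (a : M)) fun _ => x : ({a} : Set M) ⊕ Unit → M) ∘
        Sum.map (fun _ : Unit => ⟨a, rfl⟩) id = Sum.elim (fun _ => a) fun _ => x := by
      funext i
      rcases i with i | i <;> rfl
    rw [this]

lemma df_mono {A B : Set M} (h : A ⊆ B) : df L A ⊆ df L B := by
  intro b hb
  obtain ⟨ψ, hψ⟩ := mem_df_iff.1 hb
  refine mem_df_iff.2 ⟨ψ.relabel (Sum.map (Set.inclusion h) id), fun x => ?_⟩
  rw [Formula.realize_relabel, ← hψ]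
  have : (Sum.elim (fun a => (a : M)) fun _ => x : B ⊕ Unit → M) ∘ Sum.map (Set.inclusion h) id =
      Sum.elim (fun a : A => (a : M)) fun _ => x := by
    funext i
    rcases i with i | i <;> rfl
  rw [this]

lemma mem_df_trans {a b c : M} (hb : b ∈ df L {a}) (hc : c ∈ df L {b}) : c ∈ df L {a} := by
  obtain ⟨φ, hφ⟩ := mem_df_singleton_iff.1 hb
  obtain ⟨ψ, hψ⟩ := mem_df_singleton_iff.1 hc
  refine mem_df_singleton_iff.2 ⟨Formula.iExs Unit
    (φ.relabel (Sum.elim (fun _ => .inl (.inl ())) Sum.inr) ⊓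
      ψ.relabel (Sum.elim Sum.inr (fun _ => .inl (.inr ())))), fun x => ?_⟩
  simp only [Formula.realize_iExs, Formula.realize_inf, Formula.realize_relabel]
  have h1 : ∀ i : Unit → M, (Sum.elim (Sum.elim (fun _ => a) fun _ => x) i) ∘
      (Sum.elim (fun _ => .inl (.inl ())) Sum.inr : Unit ⊕ Unit → (Unit ⊕ Unit) ⊕ Unit) =
      Sum.elim (fun _ => a) (fun _ => i ()) := fun i => by funext j; rcases j with j | j <;> rfl
  have h2 : ∀ i : Unit → M, (Sum.elim (Sum.elim (fun _ => a) fun _ => x) i) ∘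
      (Sum.elim Sum.inr (fun _ => .inl (.inr ())) : Unit ⊕ Unit → (Unit ⊕ Unit) ⊕ Unit) =
      Sum.elim (fun _ => i ()) (fun _ => x) := fun i => by funext j; rcases j with j | j <;> rfl
  simp only [h1, h2, hφ]
  constructor
  · rintro ⟨i, hi, h⟩
    rw [hi] at h
    exact (hψ x).1 h
  · intro h
    exact ⟨fun _ => b, rfl, (hψ x).2 h⟩

/-- The map from definable elements to defining formulas is injective. -/
lemma countable_df_singleton [Countable L.Symbols] (a : M) : (df L {a}).Countable := by
  have : ∀ b : df L {a}, ∃ ψ : L.Formula (Unit ⊕ Unit),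
      ∀ x, ψ.Realize (Sum.elim (fun _ => a) fun _ => x) ↔ x = b :=
    fun b => mem_df_singleton_iff.1 b.2
  choose F hF using this
  refine Function.Injective.countable (f := F) fun b c h => Subtype.ext ?_
  exact (hF c b).1 (h ▸ (hF b b).2 rfl)

/-- The formula `∀ x, ψ(p, x) ↔ x = q`, saying that `ψ` defines `q` from `p`. -/
noncomputable def definesF (ψ : L.Formula (Unit ⊕ Unit)) : L.Formula (Unit ⊕ Unit) :=
  Formula.iAlls Unit ((ψ.relabel (Sum.elim (fun _ => .inl (.inl ())) Sum.inr)).iff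
    ((Term.var (.inr ())).equal (Term.var (.inl (.inr ())))))

lemma realize_definesF (ψ : L.Formula (Unit ⊕ Unit)) (p q : M) :
    (definesF ψ).Realize (Sum.elim (fun _ => p) fun _ => q) ↔
      ∀ x, ψ.Realize (Sum.elim (fun _ => p) fun _ => x) ↔ x = q := by
  simp only [definesF, Formula.realize_iAlls, Formula.realize_iff, Formula.realize_relabel,
    Formula.realize_equal]
  have h1 : ∀ i : Unit → M, (fun j => Sum.elim (Sum.elim (fun _ => p) fun _ => q) i j) ∘
      (Sum.elim (fun _ => .inl (.inl ())) Sum.inr : Unit ⊕ Unit → (Unit ⊕ Unit) ⊕ Unit) =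
      Sum.elim (fun _ => p) (fun _ => i ()) := fun i => by funext j; rcases j with j | j <;> rfl
  simp only [h1]
  exact ⟨fun h x => h fun _ => x, fun h i => h (i ())⟩

/-- An elementary embedding preserves the fact that a given formula defines an element. -/
lemma map_mem_df_singleton {N : Type*} [L.Structure N] (f : M ↪ₑ[L] N) {a b : M}
    (h : b ∈ df L {a}) : f b ∈ df L {f a} := by
  obtain ⟨ψ, hψ⟩ := mem_df_singleton_iff.1 h
  refine mem_df_singleton_iff.2 ⟨ψ, (realize_definesF ψ _ _).1 ?_⟩
  have := (f.map_formula (definesF ψ) (Sum.elim (fun _ => a) fun _ => b)).2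
    ((realize_definesF ψ a b).2 hψ)
  rwa [show f ∘ (Sum.elim (fun _ => a) fun _ => b) = Sum.elim (fun _ => f a) fun _ => f b by
    funext j; rcases j with j | j <;> rfl] at this

/-- In a countably infinite structure the majority sets are the cofinite sets. -/
lemma mem_mj_iff [Countable M] [Infinite M] {X : Set M} : X ∈ mj M ↔ Xᶜ.Finite := by
  have hX : ∀ Y : Set M, #Y ≤ ℵ₀ := fun Y => Cardinal.mk_le_aleph0
  constructor
  · intro h
    rw [← Set.finite_coe_iff, ← Cardinal.lt_aleph0_iff_finite]
    exact lt_of_lt_of_le h (hX X)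
  · intro h
    have hinf : X.Infinite := fun hfin => Set.infinite_univ (α := M) <| by
      rw [← Set.union_compl_self X]
      exact hfin.union h
    have : Infinite X := hinf.to_subtype
    exact (Cardinal.lt_aleph0_iff_finite.2 h.to_subtype).trans_le (Cardinal.aleph0_le_mk X)

end Definability

/-! ### Typicality and definability in models of arithmetic -/

section Arithmetic

variable {M : Type*} [arith.Structure M] [M ⊨ arith.PA]

/-- In a model of arithmetic, algebraic and definable closure coincide: the largest element of a
finite definable set is definable, and so is the set of the remaining ones. -/
lemma mem_df_of_finite {A : Set M} (ψ : arith.Formula (A ⊕ Unit))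
    (hfin : {x | ψ.Realize (Sum.elim (fun a => (a : M)) fun _ => x)}.Finite) {a : M}
    (ha : ψ.Realize (Sum.elim (fun a => (a : M)) fun _ => a)) : a ∈ df arith A := by
  induction hn : {x | ψ.Realize (Sum.elim (fun a => (a : M)) fun _ => x)}.ncard
    using Nat.strong_induction_on generalizing ψ with
  | _ n ih =>
  set D := {x | ψ.Realize (Sum.elim (fun a => (a : M)) fun _ => x)} with hD
  let _ := arith.linearOrderOfPA M
  -- `θ(x)` says that `x` is not the largest element of `D`
  let θ : arith.Formula (A ⊕ Unit) := Formula.iExs Unit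
    (ψ.relabel (Sum.map Sum.inl id) ⊓
      (arith.leF (.inl (.inr ())) (.inr ()) ⊓
        ∼((Term.var (.inl (.inr ()))).equal (Term.var (.inr ())))))
  have hθ : ∀ x, θ.Realize (Sum.elim (fun a => (a : M)) fun _ => x) ↔ ∃ y ∈ D, x < y := by
    intro x
    simp only [θ, Formula.realize_iExs, Formula.realize_inf, Formula.realize_relabel,
      Formula.realize_not, arith.realize_leF, Formula.realize_equal, Term.realize_var,
      Sum.elim_inl, Sum.elim_inr]
    have h1 : ∀ i : Unit → M, (Sum.elim (Sum.elim (fun a : A => (a : M)) fun _ : Unit => x) i) ∘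
        (Sum.map Sum.inl id) = Sum.elim (fun a : A => (a : M)) (fun _ => i ()) :=
      fun i => by funext j; rcases j with j | j <;> rfl
    simp only [h1]
    constructor
    · rintro ⟨i, h2, h3, h4⟩
      exact ⟨i (), h2, lt_of_le_of_ne h3 h4⟩
    · rintro ⟨y, h2, h3⟩
      exact ⟨fun _ => y, h2, h3.le, h3.ne⟩
  obtain ⟨m, hm, hmax⟩ := Set.exists_max_image D id hfin ⟨a, ha⟩
  -- if `a` is the maximum of `D`, then `ψ ∧ ¬θ` defines it; otherwise replace `ψ` by `ψ ∧ θ`,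
  -- which removes the maximum
  by_cases ham : a = m
  · refine mem_df_iff.2 ⟨ψ ⊓ ∼θ, fun x => ?_⟩
    rw [Formula.realize_inf, Formula.realize_not, hθ]
    constructor
    · rintro ⟨hx, h⟩
      push Not at h
      exact le_antisymm (ham ▸ hmax x hx) (ham ▸ h m hm)
    · rintro rfl
      refine ⟨ha, ?_⟩
      rintro ⟨y, hy, hlt⟩
      exact (hmax y hy).not_gt (ham ▸ hlt)
  · have hsub : {x | (ψ ⊓ θ).Realize (Sum.elim (fun a => (a : M)) fun _ => x)} ⊂ D := by
      refine (Set.ssubset_iff_of_subset fun x hx => (Formula.realize_inf.1 hx).1).2 ⟨m, hm, ?_⟩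
      intro h
      obtain ⟨y, hy, hlt⟩ := (hθ m).1 (Formula.realize_inf.1 h).2
      exact (hmax y hy).not_gt hlt
    exact ih _ (hn ▸ Set.ncard_lt_ncard hsub hfin) (ψ ⊓ θ) (hfin.subset hsub.subset)
      (Formula.realize_inf.2 ⟨ha, (hθ a).2 ⟨m, hm, lt_of_le_of_ne (hmax a ha) ham⟩⟩) rfl

lemma isTypical_of_notMem_df [Countable M] {A : Set M} {a : M} (ha : a ∉ df arith A) :
    IsTypical arith A a := by
  intro φ hφ
  have := arith.infinite_of_models_PA (M := M)
  by_contra hna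
  obtain ⟨ψ, hψ⟩ := exists_ext_eq_iff.1 ⟨φ, rfl⟩
  refine ha (mem_df_of_finite (∼ψ) ((mem_mj_iff.1 hφ).subset fun x hx => ?_) ?_)
  · exact fun h => Formula.realize_not.1 hx ((hψ x).2 h)
  · rw [Formula.realize_not, hψ]
    exact hna

lemma notMem_df_of_isTypical [Countable M] {A : Set M} {a : M} (ha : IsTypical arith A a) :
    a ∉ df arith A := by
  intro h
  have := arith.infinite_of_models_PA (M := M)
  obtain ⟨ψ, hψ⟩ := mem_df_iff.1 h
  obtain ⟨φ, hφ⟩ := (exists_ext_eq_iff (X := {a}ᶜ)).2 ⟨∼ψ, fun x => by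
    rw [Formula.realize_not, hψ]; rfl⟩
  have := ha φ (mem_mj_iff.2 (by rw [hφ, compl_compl]; exact Set.finite_singleton a))
  rw [hφ] at this
  exact this rfl

/-- In a countable model of arithmetic, to be typical over a finite tuple is to be undefinable
from it. -/
lemma tp_iff_notMem_df [Countable M] {a : M} {b : List M} :
    Tp arith a b ↔ a ∉ df arith {x | x ∈ b} :=
  ⟨notMem_df_of_isTypical, isTypical_of_notMem_df⟩

end Arithmetic

end Typicality

namespace arith

open FirstOrder.Language Typicality

/-! ### A model with asymmetric definability -/

instance : Countable arith.Symbols := by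
  have h : ∀ n, Countable (arith.Functions n) := fun n => by
    refine Function.Injective.countable
      (f := fun g : ArithFunc n => match g with | .zero => 0 | .succ => 1 | .add => 2 | .mul => 3) ?_
    intro g g' hg
    cases g <;> cases g' <;> first | rfl | simp_all
  have h' : ∀ n, Countable (arith.Relations n) := fun n =>
    inferInstanceAs (Countable Empty)
  unfold Language.Symbols
  infer_instance

section Pairing

variable {M : Type*} [arith.Structure M]

/-- The pairing function `(x, y) ↦ (x + y)² + x`. -/
def pairM (x y : M) : M := addM (mulM (addM x y) (addM x y)) x

/-- The sentence saying that the pairing function `pairM` is injective. -/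
noncomputable def pairInjective : arith.Sentence :=
  ∀' ∀' ∀' ∀' ((addT (mulT (addT (&0) (&1)) (addT (&0) (&1))) (&0) ='
    addT (mulT (addT (&2) (&3)) (addT (&2) (&3))) (&2)) ⟹ ((&0 =' &2) ⊓ (&1 =' &3)))

lemma realize_pairInjective :
    M ⊨ pairInjective ↔ ∀ x y z w : M, pairM x y = pairM z w → x = z ∧ y = w := by
  simp [pairInjective, Sentence.Realize, Formula.Realize, pairM, Fin.snoc]

lemma nat_pairInjective : ℕ ⊨ pairInjective := by
  rw [realize_pairInjective]
  intro x y z w h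
  replace h : (x + y) * (x + y) + x = (z + w) * (z + w) + z := h
  have h1 : x + y = z + w := by
    -- `(x + y)²` is the largest square below the common value, since `x < 2 (x + y) + 1`
    rcases lt_trichotomy (x + y) (z + w) with h' | h' | h'
    · nlinarith
    · exact h'
    · nlinarith
  rw [h1] at h
  omega

/-- Injectivity of `pairM` lets both components be recovered from a pair by a formula. -/
lemma mem_df_pairM (h : M ⊨ pairInjective) (a c : M) :
    a ∈ df arith {pairM a c} ∧ c ∈ df arith {pairM a c} := by
  rw [realize_pairInjective] at h
  constructor
  · refine mem_df_singleton_iff.2 ⟨Formula.iExs Unit ((Term.var (.inl (.inl ()))).equal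
      (addT (mulT (addT (Term.var (.inl (.inr ()))) (Term.var (.inr ())))
        (addT (Term.var (.inl (.inr ()))) (Term.var (.inr ())))) (Term.var (.inl (.inr ()))))),
      fun x => ?_⟩
    simp only [Formula.realize_iExs, Formula.realize_equal, realize_addT, realize_mulT,
      Term.realize_var, Sum.elim_inl, Sum.elim_inr]
    exact ⟨fun ⟨i, hi⟩ => (h _ _ _ _ hi).1.symm, fun hx => ⟨fun _ => c, by rw [hx]; rfl⟩⟩
  · refine mem_df_singleton_iff.2 ⟨Formula.iExs Unit ((Term.var (.inl (.inl ()))).equal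
      (addT (mulT (addT (Term.var (.inr ())) (Term.var (.inl (.inr ()))))
        (addT (Term.var (.inr ())) (Term.var (.inl (.inr ()))))) (Term.var (.inr ())))),
      fun x => ?_⟩
    simp only [Formula.realize_iExs, Formula.realize_equal, realize_addT, realize_mulT,
      Term.realize_var, Sum.elim_inl, Sum.elim_inr]
    exact ⟨fun ⟨i, hi⟩ => (h _ _ _ _ hi).2.symm, fun hx => ⟨fun _ => a, by rw [hx]; rfl⟩⟩

end Pairing

/-- The numeral of `n`. -/
def numeralT {α : Type*} : ℕ → arith.Term α
  | 0 => zeroT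
  | n + 1 => succT (numeralT n)

lemma realize_numeralT_nat {α : Type*} (v : α → ℕ) (n : ℕ) :
    (numeralT n : arith.Term α).realize v = n := by
  induction n with
  | zero => exact realize_zeroT
  | succ n ih => rw [numeralT, realize_succT, ih]; rfl

/-- Every element of a standard model is the value of a numeral, hence definable. -/
lemma nonstandard_of_notMem_df {M : Type*} [arith.Structure M] {a : M} (ha : a ∉ df arith ∅) :
    Nonstandard M := by
  refine ⟨fun e => ha ?_⟩
  refine mem_df_iff.2 ⟨(Term.var (.inr ())).equal (numeralT (e.symm a)), fun x => ?_⟩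
  have hv : (Sum.elim (fun a : (∅ : Set M) => (a : M)) fun _ : Unit => x) =
      e ∘ (fun i => e.symm (Sum.elim (fun a : (∅ : Set M) => (a : M)) (fun _ : Unit => x) i)) := by
    funext i; simp
  rw [Formula.realize_equal, Term.realize_var, Sum.elim_inr, hv, HomClass.realize_term,
    realize_numeralT_nat, e.apply_symm_apply]

/-- An uncountable structure elementarily equivalent to `ℕ` contains `a` and `c` undefinable from
`0` and from `a` respectively, as only countably many elements are definable from a given one. A
countable elementary substructure containing `a` and `c`, together with `a` and the pair of `a` and
`c`, is as required. -/
lemma exists_countable_model_definable_asymmetric :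
    ∃ (M : Type) (_ : arith.Structure M), Countable M ∧ M ⊨ PA ∧ Nonstandard M ∧
      ∃ a b : M, a ∉ df arith ∅ ∧ a ∈ df arith {b} ∧ b ∉ df arith {a} := by
  have hL : arith.card ≤ ℵ₀ := Cardinal.mk_le_aleph0 (α := arith.Symbols)
  obtain ⟨N, hN, hcard⟩ := exists_elementarilyEquivalent_card_eq arith ℕ
    (Cardinal.aleph 1 : Cardinal.{0}) (Cardinal.aleph0_le_aleph 1)
    (by simpa using hL.trans (Cardinal.aleph0_le_aleph 1))
  have hunc : ∀ x : N, ∃ y, y ∉ df arith {x} := fun x => by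
    by_contra! h
    have : (Set.univ : Set N).Countable := (countable_df_singleton x).mono fun y _ => h y
    rw [Set.countable_univ_iff, ← Cardinal.mk_le_aleph0_iff, hcard] at this
    exact Cardinal.aleph0_lt_aleph_one.not_ge this
  obtain ⟨a, ha⟩ := hunc (zeroM N)
  obtain ⟨c, hc⟩ := hunc a
  obtain ⟨S, hS, hScard⟩ := exists_elementarySubstructure_card_eq arith ({zeroM N, a, c} : Set N)
    (ℵ₀ : Cardinal.{0}) le_rfl (by simp) (by simpa using hL)
    (by simp [hcard])
  have hequiv : ℕ ≅[arith] S := hN.trans S.elementarilyEquivalent.symm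
  have hpair : S ⊨ pairInjective := (hequiv.realize_sentence _).1 nat_pairInjective
  let a' : S := ⟨a, hS (by simp)⟩
  let c' : S := ⟨c, hS (by simp)⟩
  have ha' : a' ∉ df arith ∅ := fun h => ha <|
    map_mem_df_singleton S.subtype (a := ⟨zeroM N, hS (by simp)⟩)
      (df_mono (Set.empty_subset _) h)
  refine ⟨S, inferInstance, Cardinal.mk_le_aleph0_iff.1 (by simpa using hScard.le),
    (hequiv.theory_model_iff).1 nat_models_PA, nonstandard_of_notMem_df ha', a', pairM a' c', ha',
    (mem_df_pairM hpair a' c').1, fun h => hc ?_⟩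
  exact map_mem_df_singleton S.subtype (mem_df_trans h (mem_df_pairM hpair a' c').2)

end arith

/-! ### Failure of the exchange principle -/

theorem mainTheorem10 :
    (∀ (M : Type*) [arith.Structure M] [Countable M], M ⊨ arith.PA → arith.Nonstandard M →
      ∀ a b : M, a ∉ Typicality.df arith ∅ → a ∈ Typicality.df arith {b} →
        b ∉ Typicality.df arith {a} →
        Typicality.Tp arith a [] ∧ Typicality.Tp arith b [a] ∧ ¬ Typicality.Tp arith a [b] ∧
          ¬ Typicality.SteinitzExchange arith M) ∧
    (∃ (M : Type) (_ : arith.Structure M), Countable M ∧ M ⊨ arith.PA ∧ arith.Nonstandard M ∧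
      ∃ a b : M, a ∉ Typicality.df arith ∅ ∧ a ∈ Typicality.df arith {b} ∧
        b ∉ Typicality.df arith {a}) := by
  refine ⟨?_, arith.exists_countable_model_definable_asymmetric⟩
  intro M _ _ hM _ a b ha hab hba
  have h1 : Typicality.Tp arith a [] := Typicality.tp_iff_notMem_df.2 (by simpa using ha)
  have h2 : Typicality.Tp arith b [a] := Typicality.tp_iff_notMem_df.2 (by simpa using hba)
  have h3 : ¬ Typicality.Tp arith a [b] := fun h =>
    Typicality.tp_iff_notMem_df.1 h (by simpa using hab)
  exact ⟨h1, h2, h3, fun h => h3 (h a b [] h1 h2)⟩
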